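/- Let $n\ge 0$, let $f:\mathbb{R}^n\to\mathbb{R}^n$ be continuous with $f(0)=0$, and suppose that the ODE $\dot x=f(x)$ has a unique solution map $\phi:\mathbb{R}^n\times[0,\infty)\to\mathbb{R}^n$, i.e. $\partial_t\phi(x,t)=f(\phi(x,t))$, $\phi(x,0)=x$. Write $\|\cdot\|$ for the Euclidean norm and $B_R(0)=\{y:\|y\|<R\}$. The ODE is called - locally asymptotically stable if for every $\varepsilon>0$ there is $\delta>0$ with $\|\phi(x,t)\|<\varepsilon$ for all $x\in B_\delta(0)$, $t\ge0$, and there is $\delta>0$ with $\lim_{t\to\infty}\|\phi(x,t)\|=0$ for all $x\in B_\delta(0)$; - locally exponentially stable if there are $\mu,\lambda,\delta>0$ with $\|\phi(x,t)\|\le\mu e^{-\lambda t}\|x\|$ for all $x\in B_\delta(0)$, $t\ge 0$; - a gradient system if $f=-\nabla V$ for some $V\in C^1(\mathbb{R}^n,\mathbb{R})$ with $\nabla V(0)=0$, $V\ge0$, and $V(y)=0$ if and only if $y=0$. (i) Suppose that $f\in C^1$ and the ODE is locally exponentially stable, or that $n=1$ and the ODE is locally asymptotically stable. Then there are $R>0$,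 $c_1,c_2>0$, a function $\alpha:[0,\infty)\to[0,\infty)$ with $\alpha(0)=0$, and $W\in C^1(\mathbb{R}^n,\mathbb{R})$ such that $W\ge0$ on $B_R(0)$, $W(y)=0$ if and only if $y=0$, and $$\nabla W(y)^\top f(y)<-c_1\,\alpha(\|y\|)^2,\qquad \|\nabla W(y)\|<c_2\,\alpha(\|y\|)\qquad\text{for all } y\in B_R(0)\setminus\{0\}$$ (at $y=0$ both hold with equality). (ii) Suppose that the ODE is a gradient system. Then there are $R>0$, $c_1,c_2>0$, a function $\alpha:\mathbb{R}^n\to[0,\infty)$ with $\alpha(0)=0$, and $W\in C^1(\mathbb{R}^n,\mathbb{R})$ such that $W\ge0$ on $B_R(0)$, $W(y)=0$ if and only if $y=0$, and $$\nabla W(y)^\top f(y)\le-c_1\,\alpha(y)^2,\qquad \|\nabla W(y)\|\le c_2\,\alpha(y)\qquad\text{for all } y\in B_R(0),$$ both inequalities being strict at every $y\in B_R(0)$ with $f(y)\neq0$. (In particular they are strict on a punctured ball if $0$ is an isolated critical point of $V$.) -/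

import Mathlib

open scoped NNReal

/-- The state space `ℝⁿ` with the Euclidean norm. -/
abbrev State (n : ℕ) : Type := EuclideanSpace ℝ (Fin n)

/-- `φ` is a solution map over `D × I` of the ODE `x' = f x`
(the time derivative is one-sided at an end point of `I`). -/
def IsSolutionMap {n : ℕ} (f : State n → State n) (φ : State n → ℝ → State n)
    (D : Set (State n)) (I : Set ℝ) : Prop :=
  ∀ x ∈ D, φ x 0 = x ∧ ∀ t ∈ I, HasDerivWithinAt (φ x) (f (φ x t)) I t

/-- `φ` is the unique solution map of `x' = f x` over `ℝⁿ × [0, ∞)`. -/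
def IsUniqueSolutionMap {n : ℕ} (f : State n → State n) (φ : State n → ℝ → State n) : Prop :=
  IsSolutionMap f φ Set.univ (Set.Ici 0) ∧
    ∀ ψ : State n → ℝ → State n, IsSolutionMap f ψ Set.univ (Set.Ici 0) →
      ∀ x : State n, ∀ t : ℝ, 0 ≤ t → ψ x t = φ x t

/-- The origin is stable for the flow `φ`. -/
def IsStable {n : ℕ} (φ : State n → ℝ → State n) : Prop :=
  ∀ ε : ℝ, 0 < ε → ∃ δ : ℝ, 0 < δ ∧
    ∀ x ∈ Metric.ball (0 : State n) δ, ∀ t : ℝ, 0 ≤ t → ‖φ x t‖ < ε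

/-- The origin is (locally) asymptotically stable for the flow `φ`. -/
def IsLocallyAsymptoticallyStable {n : ℕ} (φ : State n → ℝ → State n) : Prop :=
  IsStable φ ∧ ∃ δ : ℝ, 0 < δ ∧
    ∀ x ∈ Metric.ball (0 : State n) δ,
      Filter.Tendsto (fun t : ℝ => ‖φ x t‖) Filter.atTop (nhds 0)

/-- The origin is (locally) exponentially stable for the flow `φ`. -/
def IsLocallyExponentiallyStable {n : ℕ} (φ : State n → ℝ → State n) : Prop :=
  ∃ mu lam δ : ℝ, 0 < mu ∧ 0 < lam ∧ 0 < δ ∧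
    ∀ x ∈ Metric.ball (0 : State n) δ, ∀ t : ℝ, 0 ≤ t →
      ‖φ x t‖ ≤ mu * Real.exp (-lam * t) * ‖x‖

/-- `f = -∇V` for a `C¹` function `V` that is positive definite and has a critical point at `0`. -/
def IsGradientSystem {n : ℕ} (f : State n → State n) : Prop :=
  ∃ V : State n → ℝ, ContDiff ℝ 1 V ∧ (∀ y, f y = -gradient V y) ∧ gradient V 0 = 0 ∧
    (∀ y, 0 ≤ V y) ∧ ∀ y, V y = 0 ↔ y = 0

/-- `W` is `C¹`, nonnegative on `B_R(0)`, zero exactly at the origin, and on `B_R(0)` satisfies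
`∇Wᵀ f ≤ -c₁ α²` and `‖∇W‖ ≤ c₂ α`, where `α ≥ 0` and `α 0 = 0`. -/
structure HasLyapunovBounds {n : ℕ} (f : State n → State n) (W : State n → ℝ)
    (α : State n → ℝ≥0) (R c₁ c₂ : ℝ) : Prop where
  contDiff : ContDiff ℝ 1 W
  nonneg : ∀ y ∈ Metric.ball (0 : State n) R, 0 ≤ W y
  eq_zero_iff : ∀ y, W y = 0 ↔ y = 0
  alpha_zero : α 0 = 0
  decay_le : ∀ y ∈ Metric.ball (0 : State n) R,
    inner ℝ (gradient W y) (f y) ≤ -c₁ * (α y : ℝ) ^ 2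
  gradient_le : ∀ y ∈ Metric.ball (0 : State n) R, ‖gradient W y‖ ≤ c₂ * (α y : ℝ)

/-- Both bounds hold strictly at the point `y`. -/
def StrictBoundsAt {n : ℕ} (f : State n → State n) (W : State n → ℝ)
    (α : State n → ℝ≥0) (c₁ c₂ : ℝ) (y : State n) : Prop :=
  inner ℝ (gradient W y) (f y) < -c₁ * (α y : ℝ) ^ 2 ∧ ‖gradient W y‖ < c₂ * (α y : ℝ)

/-!
For an exponentially stable `C¹` system, let `A = Df(0)`. By Grönwall's inequality a solution of the
nonlinear system starting at a small `x` differs from `exp(tA) x` by `o(‖x‖)` on a fixed time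
interval, so the decay of the flow forces `‖exp(TA)‖ ≤ 1/2` for some `T`
(`IsLocallyExponentiallyStable.exists_exp_contraction`). The quadratic form
`W(x) = ∫₀ᵀ ‖exp(tA) x‖² dt` is then positive definite and decreases along `x' = A x` at the rate
`‖x‖² - ‖exp(TA) x‖² ≥ (3/4) ‖x‖²` (`exists_posDef_lyapunov_operator`); replacing `A x` by `f x`
costs only `o(‖x‖²)`, so `α(r) = r` works near the origin.

On the line, asymptotic stability and uniqueness of solutions force `y f(y) < 0` for small `y ≠ 0`
(`IsLocallyAsymptoticallyStable.exists_mul_neg`). With `α(|y|) = min (|f(y)|, |f(-y)|)` and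
`W'(y) = sgn(y) α(|y|)` this gives `-W' f ≥ α²` and `|W'| = α` (`exists_odd_mul_le_neg_sq`).

For a gradient system the potential itself works, with `α = ‖f‖`.
-/

/-! ### Flows with exponential decay -/

/-- The truncated Lyapunov integral `P = ∫₀ᵀ exp(tA)* exp(tA) dt`. Its quadratic form is positive
definite, and along `x' = A x` it changes at the rate `‖exp(TA) x‖² - ‖x‖²`: no spectral
information on `A` is needed. -/
theorem exists_posDef_lyapunov_operator {E : Type*} [NormedAddCommGroup E] [InnerProductSpace ℝ E]
    [CompleteSpace E] (A : E →L[ℝ] E) {T : ℝ} (hT : 0 < T) :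
    ∃ P : E →L[ℝ] E, (∀ x, x ≠ 0 → 0 < inner ℝ x (P x)) ∧
      ∀ x, inner ℝ (P x) (A x) + inner ℝ x (P (A x)) =
        ‖NormedSpace.exp (T • A) x‖ ^ 2 - ‖x‖ ^ 2 := by
  set X : ℝ → E →L[ℝ] E := fun t => NormedSpace.exp (t • A) with hX
  have hX0 : X 0 = 1 := by simp [hX]
  have hXd : ∀ t, HasDerivAt X (X t * A) t := fun t => hasDerivAt_exp_smul_const A t
  set S : ℝ → E →L[ℝ] E := fun t => star (X t) * X t with hS
  have hSd : ∀ t, HasDerivAt S (star A * S t + S t * A) t := fun t => by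
    have h := (hXd t).star.mul (hXd t)
    refine h.congr_deriv ?_
    simp only [hS, star_mul, mul_assoc]
  have hSc : Continuous S := continuous_iff_continuousAt.2 fun t => (hSd t).continuousAt
  have hSx : ∀ t x, inner ℝ x (S t x) = ‖X t x‖ ^ 2 := fun t x => by
    rw [← real_inner_self_eq_norm_sq, hS]
    simp only [mul_apply_eq_comp, ContinuousLinearMap.star_eq_adjoint]
    rw [ContinuousLinearMap.adjoint_inner_right]
  have hI : IntervalIntegrable S MeasureTheory.volume 0 T := hSc.intervalIntegrable 0 T
  refine ⟨∫ t in (0 : ℝ)..T, S t, fun x hx => ?_, fun x => ?_⟩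
  · have h1 : inner ℝ x ((∫ t in (0 : ℝ)..T, S t) x) = ∫ t in (0 : ℝ)..T, inner ℝ x (S t x) :=
      (ContinuousLinearMap.intervalIntegral_comp_comm
        ((innerSL ℝ x).comp (ContinuousLinearMap.apply ℝ E x)) hI).symm
    rw [h1]
    refine intervalIntegral.integral_pos hT (by fun_prop) (fun t _ => ?_)
      ⟨0, ⟨le_rfl, hT.le⟩, ?_⟩
    · rw [hSx]; positivity
    · rw [hSx, hX0]
      exact pow_pos (norm_pos_iff.2 hx) 2
  · set P := ∫ t in (0 : ℝ)..T, S t with hP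
    have h1 : star A * P + P * A = S T - S 0 := by
      have hl : (∫ t in (0 : ℝ)..T, star A * S t) = star A * P :=
        ContinuousLinearMap.intervalIntegral_comp_comm
          (ContinuousLinearMap.mul ℝ (E →L[ℝ] E) (star A)) hI
      have hr : (∫ t in (0 : ℝ)..T, S t * A) = P * A :=
        ContinuousLinearMap.intervalIntegral_comp_comm
          ((ContinuousLinearMap.mul ℝ (E →L[ℝ] E)).flip A) hI
      have hcl : Continuous fun t => star A * S t := continuous_const.mul hSc
      have hcr : Continuous fun t => S t * A := hSc.mul continuous_const
      rw [← hl, ← hr, ← intervalIntegral.integral_add (hcl.intervalIntegrable 0 T)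
        (hcr.intervalIntegrable 0 T)]
      exact intervalIntegral.integral_eq_sub_of_hasDerivAt (fun t _ => hSd t)
        ((hcl.add hcr).intervalIntegrable 0 T)
    have h2 : inner ℝ (P x) (A x) = inner ℝ x ((star A * P) x) := by
      rw [mul_apply_eq_comp, ContinuousLinearMap.star_eq_adjoint,
        ContinuousLinearMap.adjoint_inner_right, real_inner_comm]
    have h3 : inner ℝ x (P (A x)) = inner ℝ x ((P * A) x) := rfl
    have h4 : ‖x‖ ^ 2 = inner ℝ x (S 0 x) := by rw [hSx, hX0]; simp
    rw [h2, h3, ← inner_add_right, ← add_apply, h1, h4, ← hSx,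
      sub_apply, inner_sub_right]

theorem HasFDerivAt.exists_norm_sub_le {E F : Type*} [NormedAddCommGroup E] [NormedSpace ℝ E]
    [NormedAddCommGroup F] [NormedSpace ℝ F] {f : E → F} {A : E →L[ℝ] F}
    (hA : HasFDerivAt f A 0) (hf0 : f 0 = 0) {η : ℝ} (hη : 0 < η) :
    ∃ r > 0, ∀ y, ‖y‖ < r → ‖f y - A y‖ ≤ η * ‖y‖ := by
  obtain ⟨r, hr, h⟩ := Metric.eventually_nhds_iff_ball.1
    ((hasFDerivAt_iff_isLittleO_nhds_zero.1 hA).def hη)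
  exact ⟨r, hr, fun y hy => by simpa [hf0] using h y (by simpa using hy)⟩

/-- The solution stays in the region where `f` is close to its linearization, so Grönwall's
inequality passes the exponential decay of the nonlinear flow on to `exp(TA)`. -/
theorem IsLocallyExponentiallyStable.exists_exp_contraction {n : ℕ} {f : State n → State n}
    {φ : State n → ℝ → State n} {A : State n →L[ℝ] State n} (hA : HasFDerivAt f A 0)
    (hf0 : f 0 = 0) (hφ : IsSolutionMap f φ Set.univ (Set.Ici 0))
    (hs : IsLocallyExponentiallyStable φ) :
    ∃ T : ℝ, 0 < T ∧ ∀ x, ‖NormedSpace.exp (T • A) x‖ ≤ 1 / 2 * ‖x‖ := by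
  obtain ⟨μ, l, δ, hμ, hl, hδ, hb⟩ := hs
  obtain ⟨T, hT, hTμ⟩ : ∃ T : ℝ, 0 < T ∧ μ * Real.exp (-l * T) ≤ 1 / 4 := by
    have h1 : Filter.Tendsto (fun T : ℝ => μ * Real.exp (-l * T)) Filter.atTop (nhds (μ * 0)) :=
      (Real.tendsto_exp_atBot.comp
        (Filter.tendsto_id.const_mul_atTop_of_neg (neg_lt_zero.2 hl))).const_mul μ
    rw [mul_zero] at h1
    exact ((Filter.eventually_gt_atTop 0).and
      (h1.eventually (ge_mem_nhds (by norm_num : (0 : ℝ) < 1 / 4)))).exists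
  refine ⟨T, hT, ?_⟩
  set K : ℝ≥0 := ‖A‖₊ + 1 with hK
  have hK0 : (0 : ℝ) < K := by rw [hK]; positivity
  have hlip : LipschitzWith K A := A.lipschitz.weaken (by simp [hK])
  set C : ℝ := (Real.exp (K * T) - 1) / K with hC
  have hC0 : 0 < C := by
    have h1 := mul_pos hK0 hT
    exact div_pos (by linarith [Real.add_one_lt_exp h1.ne']) hK0
  -- `η` makes the Grönwall error `η μ C ‖x‖` equal to `‖x‖ / 4`.
  set η : ℝ := 1 / (4 * μ * C) with hη
  have hη0 : 0 < η := by positivity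
  obtain ⟨r, hr, hrb⟩ : ∃ r > 0, ∀ y : State n, ‖y‖ < r → ‖f y - A y‖ ≤ η * ‖y‖ :=
    hA.exists_norm_sub_le hf0 hη0
  have hsmall : ∀ x : State n, ‖x‖ < δ → μ * ‖x‖ < r →
      ‖NormedSpace.exp (T • A) x‖ ≤ 1 / 2 * ‖x‖ := fun x hx hxr => by
    have hbx := hb x (by simpa using hx)
    obtain ⟨hx0, hd⟩ := hφ x (Set.mem_univ x)
    have hbt : ∀ t, 0 ≤ t → ‖φ x t‖ ≤ μ * ‖x‖ := fun t ht => by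
      refine (hbx t ht).trans ?_
      have : Real.exp (-l * t) ≤ 1 := Real.exp_le_one_iff.2 (by nlinarith)
      gcongr
      nlinarith
    have hexp : ∀ t : ℝ, HasDerivAt (fun t : ℝ => NormedSpace.exp (t • A) x)
        (A (NormedSpace.exp (t • A) x)) t := fun t =>
      (ContinuousLinearMap.apply ℝ (State n) x).hasFDerivAt.comp_hasDerivAt t
        (hasDerivAt_exp_smul_const' A t)
    have hg := dist_le_of_approx_trajectories_ODE (v := fun _ => A) (a := 0) (b := T) (δ := 0)
      (f := φ x) (f' := fun t => f (φ x t)) (εf := η * (μ * ‖x‖)) (εg := 0)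
      (g := fun t : ℝ => NormedSpace.exp (t • A) x)
      (g' := fun t : ℝ => A (NormedSpace.exp (t • A) x))
      (fun _ => hlip)
      (fun t ht => ((hd t ht.1).continuousWithinAt).mono Set.Icc_subset_Ici_self)
      (fun t ht => (hd t ht.1).mono (Set.Ici_subset_Ici.2 ht.1))
      (fun t ht => by
        rw [dist_eq_norm]
        refine (hrb _ ((hbt t ht.1).trans_lt hxr)).trans ?_
        gcongr
        exact hbt t ht.1)
      (fun t _ => (hexp t).continuousAt.continuousWithinAt)
      (fun t _ => (hexp t).hasDerivWithinAt)
      (fun t _ => by simp)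
      (by simp [hx0, zero_smul ℝ A]) T ⟨hT.le, le_rfl⟩
    rw [gronwallBound_of_K_ne_0 hK0.ne', dist_eq_norm] at hg
    have he : (0 : ℝ) * Real.exp (K * (T - 0)) +
        (η * (μ * ‖x‖) + 0) / K * (Real.exp (K * (T - 0)) - 1) = 1 / 4 * ‖x‖ := by
      have : (0 : ℝ) * Real.exp (K * (T - 0)) +
          (η * (μ * ‖x‖) + 0) / K * (Real.exp (K * (T - 0)) - 1) = η * μ * C * ‖x‖ := by
        rw [hC, sub_zero]; ring
      rw [this, hη]
      field_simp
    beta_reduce at hg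
    rw [he] at hg
    have h1 : ‖φ x T‖ ≤ 1 / 4 * ‖x‖ := (hbx T hT.le).trans (by gcongr)
    have h2 := norm_sub_norm_le (NormedSpace.exp (T • A) x) (φ x T)
    rw [norm_sub_rev] at h2
    linarith
  intro x
  -- Both sides are homogeneous in `x`, so a small multiple of `x` decides.
  obtain ⟨c, hc, hc1, hc2⟩ : ∃ c : ℝ, 0 < c ∧ c * ‖x‖ < δ ∧ μ * (c * ‖x‖) < r := by
    have h1 : Filter.Tendsto (fun c : ℝ => c * ‖x‖) (nhdsWithin 0 (Set.Ioi 0)) (nhds 0) :=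
      ((continuous_mul_const ‖x‖).tendsto' 0 0 (by simp)).mono_left nhdsWithin_le_nhds
    have h2 := h1.const_mul μ
    rw [mul_zero] at h2
    obtain ⟨c, hc, h⟩ := (Filter.Eventually.and
      (self_mem_nhdsWithin : Set.Ioi (0 : ℝ) ∈ nhdsWithin 0 (Set.Ioi 0))
      ((h1.eventually (gt_mem_nhds hδ)).and (h2.eventually (gt_mem_nhds hr)))).exists
    exact ⟨c, hc, h.1, h.2⟩
  have h := hsmall (c • x) (by rwa [norm_smul, Real.norm_of_nonneg hc.le])
    (by rwa [norm_smul, Real.norm_of_nonneg hc.le])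
  rw [map_smul, norm_smul, norm_smul, Real.norm_of_nonneg hc.le] at h
  nlinarith

theorem hasGradientAt_inner_self_apply {E : Type*} [NormedAddCommGroup E] [InnerProductSpace ℝ E]
    [CompleteSpace E] (P : E →L[ℝ] E) (x : E) :
    HasGradientAt (fun x => inner ℝ x (P x)) (P x + star P x) x := by
  rw [hasGradientAt_iff_hasFDerivAt]
  refine ((hasFDerivAt_id x).inner ℝ P.hasFDerivAt).congr_fderiv ?_
  ext v
  simp [ContinuousLinearMap.star_eq_adjoint,
    ContinuousLinearMap.adjoint_inner_left, real_inner_comm, add_comm]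

/-- The Lyapunov function of the linearization at the origin serves the nonlinear system near the
origin, with `α` the identity. -/
theorem IsLocallyExponentiallyStable.exists_lyapunov {n : ℕ} {f : State n → State n}
    {φ : State n → ℝ → State n} (hf : ContDiff ℝ 1 f) (hf0 : f 0 = 0)
    (hφ : IsSolutionMap f φ Set.univ (Set.Ici 0)) (hs : IsLocallyExponentiallyStable φ) :
    ∃ (R c₁ c₂ : ℝ) (W : State n → ℝ) (α : ℝ≥0 → ℝ≥0), 0 < R ∧ 0 < c₁ ∧ 0 < c₂ ∧
      HasLyapunovBounds f W (fun y => α ‖y‖₊) R c₁ c₂ ∧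
      ∀ y ∈ Metric.ball (0 : State n) R, y ≠ 0 →
        StrictBoundsAt f W (fun y => α ‖y‖₊) c₁ c₂ y := by
  set A := fderiv ℝ f 0
  have hA : HasFDerivAt f A 0 := (hf.differentiable one_ne_zero 0).hasFDerivAt
  obtain ⟨T, hT, hTb⟩ := hs.exists_exp_contraction hA hf0 hφ
  obtain ⟨P, hP, hPA⟩ := exists_posDef_lyapunov_operator A hT
  set Q := P + star P with hQ
  have hgrad : ∀ y, gradient (fun x => inner ℝ x (P x)) y = Q y := fun y =>
    (hasGradientAt_inner_self_apply P y).gradient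
  have hQA : ∀ y, inner ℝ (Q y) (A y) ≤ -(3 / 4) * ‖y‖ ^ 2 := fun y => by
    have h1 : inner ℝ (Q y) (A y) = inner ℝ (P y) (A y) + inner ℝ y (P (A y)) := by
      rw [hQ, add_apply, inner_add_left, ContinuousLinearMap.star_eq_adjoint,
        ContinuousLinearMap.adjoint_inner_left]
    have h2 : ‖NormedSpace.exp (T • A) y‖ ^ 2 ≤ (1 / 2 * ‖y‖) ^ 2 := by gcongr; exact hTb y
    rw [h1, hPA]
    linarith
  set η : ℝ := 1 / (4 * (‖Q‖ + 1)) with hη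
  have hη0 : 0 < η := by positivity
  obtain ⟨R, hR, hRb⟩ : ∃ R > 0, ∀ y : State n, ‖y‖ < R → ‖f y - A y‖ ≤ η * ‖y‖ :=
    hA.exists_norm_sub_le hf0 hη0
  have hdecay : ∀ y ∈ Metric.ball (0 : State n) R,
      inner ℝ (Q y) (f y) ≤ -(1 / 2) * ‖y‖ ^ 2 := fun y hy => by
    have h1 : inner ℝ (Q y) (f y) = inner ℝ (Q y) (A y) + inner ℝ (Q y) (f y - A y) := by
      rw [← inner_add_right]; simp
    have h2 : inner ℝ (Q y) (f y - A y) ≤ ((‖Q‖ + 1) * ‖y‖) * (η * ‖y‖) :=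
      (real_inner_le_norm _ _).trans (by
        gcongr
        · exact (Q.le_opNorm y).trans (by gcongr; linarith)
        · exact hRb y (by simpa using hy))
    have h3 : ((‖Q‖ + 1) * ‖y‖) * (η * ‖y‖) = 1 / 4 * ‖y‖ ^ 2 := by
      rw [hη]; field_simp
    linarith [hQA y]
  refine ⟨R, 1 / 4, ‖Q‖ + 1, fun x => inner ℝ x (P x), id, hR, by norm_num, by positivity,
    ⟨contDiff_id.inner ℝ P.contDiff, fun y _ => ?_, fun y => ⟨fun h => ?_, fun h => by simp [h]⟩,
      by simp, fun y hy => ?_, fun y _ => ?_⟩, fun y hy hy0 => ⟨?_, ?_⟩⟩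
  · rcases eq_or_ne y 0 with rfl | h
    · simp
    · exact (hP y h).le
  · by_contra h0
    exact (hP y h0).ne' h
  · rw [hgrad]
    refine (hdecay y hy).trans ?_
    simp only [id, coe_nnnorm]
    nlinarith [sq_nonneg ‖y‖]
  · rw [hgrad]
    refine (Q.le_opNorm y).trans ?_
    simp only [id, coe_nnnorm]
    gcongr
    linarith
  · rw [hgrad]
    refine (hdecay y hy).trans_lt ?_
    simp only [id, coe_nnnorm]
    have := norm_pos_iff.2 hy0
    nlinarith [sq_pos_of_pos this]
  · rw [hgrad]
    refine (Q.le_opNorm y).trans_lt ?_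
    simp only [id, coe_nnnorm]
    have := norm_pos_iff.2 hy0
    gcongr
    linarith

/-! ### Asymptotic stability on the line -/

/-- If `f` does not point towards the origin at `x ≠ 0`, then `x` is an equilibrium or a barrier that
the solution starting there cannot cross; in both cases that solution does not tend to the
origin. -/
theorem IsLocallyAsymptoticallyStable.exists_mul_neg {f : State 1 → State 1}
    {φ : State 1 → ℝ → State 1} (hφ : IsUniqueSolutionMap f φ)
    (hs : IsLocallyAsymptoticallyStable φ) :
    ∃ δ : ℝ, 0 < δ ∧ ∀ x ∈ Metric.ball (0 : State 1) δ, x ≠ 0 → x 0 * f x 0 < 0 := by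
  obtain ⟨-, δ, hδ, hlim⟩ := hs
  refine ⟨δ, hδ, fun x hx hx0 => ?_⟩
  have hxpos : 0 < x 0 ^ 2 := by
    refine sq_pos_of_ne_zero fun h => hx0 ?_
    ext i
    rwa [Subsingleton.elim i 0]
  have hy : Filter.Tendsto (fun t => x 0 * φ x t 0) Filter.atTop (nhds 0) := by
    have h1 : Filter.Tendsto (φ x) Filter.atTop (nhds 0) :=
      tendsto_zero_iff_norm_tendsto_zero.2 (hlim x hx)
    have h2 :=
      (((EuclideanSpace.proj (𝕜 := ℝ) (0 : Fin 1)).continuous.tendsto _).comp h1).const_mul (x 0)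
    simpa using h2
  obtain ⟨hx1, hd⟩ := hφ.1 x (Set.mem_univ x)
  by_contra! hcon
  suffices h : ∀ t : ℝ, 0 ≤ t → x 0 ^ 2 ≤ x 0 * φ x t 0 by
    have := ge_of_tendsto hy (Filter.eventually_atTop.2 ⟨0, h⟩)
    linarith
  rcases hcon.eq_or_lt with h0 | hpos
  · have hfx : f x = 0 := by
      ext i
      rw [Subsingleton.elim i 0]
      rcases mul_eq_zero.1 h0.symm with h | h
      · simp [h] at hxpos
      · simpa using h
    classical
    -- The constant path at the equilibrium `x` is a solution, hence by uniqueness equals `φ x`.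
    have hψ : IsSolutionMap f (fun z t => if z = x then x else φ z t) Set.univ (Set.Ici 0) := by
      intro z hz
      by_cases hzx : z = x
      · subst hzx
        refine ⟨by simp, fun t _ => ?_⟩
        simpa [hfx] using hasDerivWithinAt_const t (Set.Ici 0) z
      · simpa [hzx] using hφ.1 z hz
    intro t ht
    have := hφ.2 _ hψ x t ht
    rw [if_pos rfl] at this
    rw [← this, sq]
  -- Multiplying by the constant `x 0` treats both signs of `x 0` at once.
  · intro t ht
    have hder : ∀ s, 0 ≤ s → HasDerivWithinAt (fun s => -(x 0 * φ x s 0))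
        (-(x 0 * f (φ x s) 0)) (Set.Ici 0) s := fun s hs =>
      (((EuclideanSpace.proj (𝕜 := ℝ) (0 : Fin 1)).hasFDerivAt.comp_hasDerivWithinAt s
        (hd s hs)).const_mul (x 0)).neg
    have := image_le_of_deriv_right_lt_deriv_boundary' (a := 0) (b := t)
      (B := fun _ => -x 0 ^ 2) (B' := fun _ => 0)
      (fun s hs => (hder s hs.1).continuousWithinAt.mono Set.Icc_subset_Ici_self)
      (fun s hs => (hder s hs.1).mono (Set.Ici_subset_Ici.2 hs.1))
      (by rw [hx1]; nlinarith) continuousOn_const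
      (fun s _ => hasDerivWithinAt_const _ _ _)
      (fun s _ he => by
        have he1 : φ x s 0 = x 0 := by
          have : x 0 ≠ 0 := fun h => by simp [h] at hxpos
          refine mul_left_cancel₀ this ?_
          linarith [sq (x 0)]
        have he2 : φ x s = x := by
          ext i
          rwa [Subsingleton.elim i 0]
        rw [he2]
        linarith) ⟨ht, le_rfl⟩
    linarith

theorem intervalIntegral_pos_of_mul_pos {k : ℝ → ℝ} (hk : Continuous k)
    (hpos : ∀ s, s ≠ 0 → 0 < s * k s) {s : ℝ} (hs : s ≠ 0) : 0 < ∫ u in (0 : ℝ)..s, k u := by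
  rcases hs.lt_or_gt with h | h
  · rw [intervalIntegral.integral_symm, ← intervalIntegral.integral_neg]
    refine intervalIntegral.intervalIntegral_pos_of_pos_on (hk.neg.intervalIntegrable _ _)
      (fun u hu => ?_) h
    have := hpos u hu.2.ne
    nlinarith [hu.2]
  · refine intervalIntegral.intervalIntegral_pos_of_pos_on (hk.intervalIntegrable _ _)
      (fun u hu => ?_) h
    exact pos_of_mul_pos_right (hpos u hu.1.ne') hu.1.le

theorem hasGradientAt_comp_coord {n : ℕ} {Φ : ℝ → ℝ} {Φ' : ℝ} {y : State n} (i : Fin n)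
    (h : HasDerivAt Φ Φ' (y i)) :
    HasGradientAt (fun y : State n => Φ (y i)) (EuclideanSpace.single i Φ') y := by
  rw [hasGradientAt_iff_hasFDerivAt]
  refine (h.comp_hasFDerivAt y (EuclideanSpace.proj (𝕜 := ℝ) i).hasFDerivAt).congr_fderiv ?_
  ext v
  simp [EuclideanSpace.inner_single_left]

/-- The function `k` is odd with `|k(s)| = min |F(±s)|` near the origin. The minimum makes `|k|`
depend on `|s|` only, although `F` itself need not be odd. -/
theorem exists_odd_mul_le_neg_sq {F : ℝ → ℝ} (hFc : Continuous F) (hF0 : F 0 = 0) {δ : ℝ}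
    (hδ : 0 < δ) (hFneg : ∀ s, s ≠ 0 → |s| < δ → s * F s < 0) :
    ∃ (R : ℝ) (k : ℝ → ℝ), 0 < R ∧ Continuous k ∧ k 0 = 0 ∧ (∀ s, |k (|s|)| = |k s|) ∧
      (∀ s, s ≠ 0 → 0 < s * k s) ∧ ∀ s, |s| < R → k s * F s ≤ -|k s| ^ 2 := by
  set R : ℝ := δ / 2 with hR
  have hR0 : 0 < R := by positivity
  -- The argument is cut off at `R`, so that `s * k s > 0` on the whole line.
  set m : ℝ → ℝ := fun s => min |F (min |s| R)| |F (-(min |s| R))| with hm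
  have hmc : Continuous m := by fun_prop
  have hm0 : m 0 = 0 := by simp [hm, hR0.le, hF0]
  have hmabs : ∀ s, m |s| = m s := fun s => by simp [hm]
  have hmpos : ∀ s, s ≠ 0 → 0 < m s := fun s hs => by
    have h1 : 0 < min |s| R := lt_min (abs_pos.2 hs) hR0
    have h2 : |min |s| R| < δ := by
      rw [abs_of_pos h1]
      exact (min_le_right _ _).trans_lt (by rw [hR]; linarith)
    refine lt_min (abs_pos.2 fun h => ?_) (abs_pos.2 fun h => ?_)
    · simpa [h] using hFneg _ h1.ne' h2
    · simpa [h] using hFneg _ (neg_ne_zero.2 h1.ne') (by rwa [abs_neg])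
  have hmF : ∀ s, |s| < R → m s ≤ |F s| := fun s hs => by
    simp only [hm, min_eq_left hs.le]
    rcases abs_choice s with h | h <;> rw [h]
    · exact min_le_left _ _
    · rw [neg_neg]
      exact min_le_right _ _
  set k : ℝ → ℝ := fun s => if 0 ≤ s then m s else -m s with hk
  have hkc : Continuous k := by
    refine hmc.if_le hmc.neg continuous_const continuous_id fun s hs => ?_
    rw [← hs, hm0, neg_zero]
  have hkabs : ∀ s, |k s| = m s := fun s => by
    have : 0 ≤ m s := le_min (abs_nonneg _) (abs_nonneg _)
    simp only [hk]
    split_ifs <;> simp [abs_of_nonneg this]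
  have hkpos : ∀ s, s ≠ 0 → 0 < s * k s := fun s hs => by
    have := hmpos s hs
    simp only [hk]
    split_ifs with h
    · exact mul_pos (h.lt_of_ne hs.symm) this
    · nlinarith
  have hkF : ∀ s, |s| < R → k s * F s ≤ -m s ^ 2 := fun s hs => by
    rcases eq_or_ne s 0 with rfl | h0
    · simp [hF0, hm0]
    · have h1 := hFneg s h0 (hs.trans (by rw [hR]; linarith))
      have h2 := hkpos s h0
      have h3 : k s * F s < 0 := by
        have h4 : 0 < s ^ 2 := by positivity
        by_contra! h5
        nlinarith [mul_nonneg h4.le h5, mul_neg_of_pos_of_neg h2 h1]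
      have h4 : k s * F s = -(m s * |F s|) := by
        rw [← hkabs, ← abs_mul, abs_of_neg h3, neg_neg]
      rw [h4, sq]
      have := hmpos s h0
      have := hmF s hs
      gcongr
  exact ⟨R, k, hR0, hkc, by simp [hk, hm0], fun s => by rw [hkabs, hkabs, hmabs], hkpos,
    fun s hs => by rw [hkabs]; exact hkF s hs⟩

/-- On the line `W(y) = ∫₀^y k` is a Lyapunov function, with `α(|y|) = |k(y)|`. -/
theorem IsLocallyAsymptoticallyStable.exists_lyapunov {f : State 1 → State 1} (hf : Continuous f)
    (hf0 : f 0 = 0) {φ : State 1 → ℝ → State 1} (hφ : IsUniqueSolutionMap f φ)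
    (hs : IsLocallyAsymptoticallyStable φ) :
    ∃ (R c₁ c₂ : ℝ) (W : State 1 → ℝ) (α : ℝ≥0 → ℝ≥0), 0 < R ∧ 0 < c₁ ∧ 0 < c₂ ∧
      HasLyapunovBounds f W (fun y => α ‖y‖₊) R c₁ c₂ ∧
      ∀ y ∈ Metric.ball (0 : State 1) R, y ≠ 0 →
        StrictBoundsAt f W (fun y => α ‖y‖₊) c₁ c₂ y := by
  obtain ⟨δ, hδ, hneg⟩ := hs.exists_mul_neg hφ
  have hsingle : ∀ y : State 1, EuclideanSpace.single 0 (y 0) = y := fun y => by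
    ext i
    simp [Subsingleton.elim i 0]
  have hnorm : ∀ y : State 1, ‖y‖ = |y 0| := fun y => by
    rw [← hsingle y]
    simp
  set F : ℝ → ℝ := fun s => f (EuclideanSpace.single 0 s) 0 with hF
  have hfF : ∀ y, f y 0 = F (y 0) := fun y => by rw [hF]; simp only [hsingle]
  have hFc : Continuous F := by
    have h1 : Continuous fun s : ℝ => (EuclideanSpace.single 0 s : State 1) :=
      Isometry.continuous (Isometry.of_dist_eq fun a b =>
        PiLp.dist_single_same 2 (fun _ : Fin 1 => ℝ) 0 a b)
    exact (EuclideanSpace.proj (𝕜 := ℝ) (0 : Fin 1)).continuous.comp (hf.comp h1)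
  have hF0 : F 0 = 0 := by simpa [hf0] using (hfF 0).symm
  have hFneg : ∀ s, s ≠ 0 → |s| < δ → s * F s < 0 := fun s hs hsδ => by
    have := hneg (EuclideanSpace.single 0 s) (by simpa using hsδ) (by simpa using hs)
    simpa [hF] using this
  obtain ⟨R, k, hR0, hkc, hk0, hkabs, hkpos, hkF⟩ :=
    exists_odd_mul_le_neg_sq hFc hF0 hδ hFneg
  set W : State 1 → ℝ := fun y => ∫ u in (0 : ℝ)..y 0, k u with hW
  have hderiv : ∀ s, HasDerivAt (fun s => ∫ u in (0 : ℝ)..s, k u) (k s) s := fun s =>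
    (hkc.integral_hasStrictDerivAt 0 s).hasDerivAt
  have hgrad : ∀ y, gradient W y = EuclideanSpace.single 0 (k (y 0)) := fun y =>
    (hasGradientAt_comp_coord 0 (hderiv (y 0))).gradient
  have hinner : ∀ y, inner ℝ (gradient W y) (f y) = k (y 0) * F (y 0) := fun y => by
    rw [hgrad, EuclideanSpace.inner_single_left, hfF]
    simp
  have hgn : ∀ y, ‖gradient W y‖ = |k (y 0)| := fun y => by
    rw [hgrad, PiLp.norm_single, Real.norm_eq_abs]
  have hα : ∀ y : State 1, (‖k ‖y‖₊‖₊ : ℝ) = |k (y 0)| := fun y => by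
    rw [coe_nnnorm, Real.norm_eq_abs, coe_nnnorm, hnorm, hkabs]
  have hkne : ∀ s, s ≠ 0 → 0 < |k s| := fun s hs =>
    abs_pos.2 fun h => by simpa [h] using hkpos s hs
  have hcoord : ∀ y : State 1, y ≠ 0 → y 0 ≠ 0 := fun y hy h => hy (by rw [← hsingle y, h]; simp)
  have hball : ∀ y ∈ Metric.ball (0 : State 1) R, |y 0| < R := fun y hy => by
    rwa [mem_ball_zero_iff, hnorm] at hy
  have hWpos : ∀ y, y ≠ 0 → 0 < W y := fun y hy =>
    intervalIntegral_pos_of_mul_pos hkc hkpos (hcoord y hy)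
  have hW0 : W 0 = 0 := by simp [hW]
  have hWc : ContDiff ℝ 1 W := by
    have h1 : ContDiff ℝ 1 fun s => ∫ u in (0 : ℝ)..s, k u := by
      rw [contDiff_one_iff_deriv]
      refine ⟨fun s => (hderiv s).differentiableAt, ?_⟩
      rwa [funext fun s => (hderiv s).deriv]
    exact h1.comp (EuclideanSpace.proj (𝕜 := ℝ) (0 : Fin 1)).contDiff
  refine ⟨R, 1 / 2, 2, W, fun r => ‖k r‖₊, hR0, by norm_num, two_pos,
    ⟨hWc, fun y _ => ?_, fun y => ⟨fun h => ?_, fun h => h ▸ hW0⟩, by simp [hk0],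
      fun y hy => ?_, fun y _ => ?_⟩, fun y hy hy0 => ⟨?_, ?_⟩⟩
  · rcases eq_or_ne y 0 with rfl | h
    · exact hW0.ge
    · exact (hWpos y h).le
  · by_contra h0
    exact (hWpos y h0).ne' h
  · rw [hinner, hα]
    nlinarith [hkF _ (hball y hy), sq_nonneg |k (y 0)|]
  · rw [hgn, hα]
    linarith [abs_nonneg (k (y 0))]
  · rw [hinner, hα]
    nlinarith [hkF _ (hball y hy), sq_pos_of_pos (hkne _ (hcoord y hy0))]
  · rw [hgn, hα]
    linarith [hkne _ (hcoord y hy0)]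

/-! ### Gradient systems -/

/-- The potential itself is the Lyapunov function, with `α = ‖f‖`. -/
theorem IsGradientSystem.exists_lyapunov {n : ℕ} {f : State n → State n} (hf0 : f 0 = 0)
    (hg : IsGradientSystem f) :
    ∃ (R c₁ c₂ : ℝ) (W : State n → ℝ) (α : State n → ℝ≥0), 0 < R ∧ 0 < c₁ ∧ 0 < c₂ ∧
      HasLyapunovBounds f W α R c₁ c₂ ∧
      ∀ y ∈ Metric.ball (0 : State n) R, f y ≠ 0 → StrictBoundsAt f W α c₁ c₂ y := by
  obtain ⟨V, hV, hfV, -, hV0, hVz⟩ := hg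
  have hgrad : ∀ y, gradient V y = -f y := fun y => by rw [hfV, neg_neg]
  have hin : ∀ y, inner ℝ (gradient V y) (f y) = -‖f y‖ ^ 2 := fun y => by
    rw [hgrad, inner_neg_left, real_inner_self_eq_norm_sq]
  refine ⟨1, 1 / 2, 2, V, fun y => ‖f y‖₊, one_pos, by norm_num, two_pos,
    ⟨hV, fun y _ => hV0 y, hVz, by simp [hf0], fun y _ => ?_, fun y _ => ?_⟩,
    fun y _ hy => ⟨?_, ?_⟩⟩
  · rw [hin, coe_nnnorm]
    nlinarith [sq_nonneg ‖f y‖]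
  · rw [hgrad, norm_neg, coe_nnnorm]
    linarith [norm_nonneg (f y)]
  · rw [hin, coe_nnnorm]
    nlinarith [sq_pos_of_pos (norm_pos_iff.2 hy)]
  · rw [hgrad, norm_neg, coe_nnnorm]
    linarith [norm_pos_iff.2 hy]

/-! ### Existence of Lyapunov functions -/

theorem mainTheorem3 (n : ℕ) (f : State n → State n) (hf : Continuous f) (hf0 : f 0 = 0)
    (φ : State n → ℝ → State n) (hφ : IsUniqueSolutionMap f φ) :
    ((ContDiff ℝ 1 f ∧ IsLocallyExponentiallyStable φ) ∨
        (n = 1 ∧ IsLocallyAsymptoticallyStable φ) →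
      ∃ (R c₁ c₂ : ℝ) (W : State n → ℝ) (α : ℝ≥0 → ℝ≥0), 0 < R ∧ 0 < c₁ ∧ 0 < c₂ ∧
        HasLyapunovBounds f W (fun y => α ‖y‖₊) R c₁ c₂ ∧
        ∀ y ∈ Metric.ball (0 : State n) R, y ≠ 0 →
          StrictBoundsAt f W (fun y => α ‖y‖₊) c₁ c₂ y) ∧
    (IsGradientSystem f →
      ∃ (R c₁ c₂ : ℝ) (W : State n → ℝ) (α : State n → ℝ≥0), 0 < R ∧ 0 < c₁ ∧ 0 < c₂ ∧
        HasLyapunovBounds f W α R c₁ c₂ ∧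
        ∀ y ∈ Metric.ball (0 : State n) R, f y ≠ 0 → StrictBoundsAt f W α c₁ c₂ y) := by
  refine ⟨?_, fun hg => hg.exists_lyapunov hf0⟩
  rintro (⟨hf1, hs⟩ | ⟨rfl, hs⟩)
  · exact hs.exists_lyapunov hf1 hf0 hφ.1
  · exact hs.exists_lyapunov hf hf0 hφ
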